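/- **Conventions.** Formulas are built from countably many variables with the connectives $\wedge,\vee,\cdot,\to,0,1$, and $\neg\varphi:=\varphi\to 0$. An $\mathrm{FL_e}$-algebra is an algebra $\mathbf A=\langle A,\wedge,\vee,\cdot,\to,0,1\rangle$ such that $\langle A,\wedge,\vee\rangle$ is a lattice, $\langle A,\cdot,1\rangle$ is a commutative monoid, $x\cdot y\le z\iff x\le y\to z$ for all $x,y,z\in A$, and $0\in A$ is an arbitrary constant; $\neg x:=x\to 0$. Put $$x\Rightarrow_\wedge y:=(x\to y)\wedge(y\to\neg\neg x),\qquad x\Rightarrow_\circ y:=(x\to y)\cdot(y\to\neg\neg x).$$ $\mathbf{FL_e}$ is the logic with $\Phi\vdash\psi$ iff the sequent $\vdash\psi$ is derivable, in the full Lambek sequent calculus with exchange (and cut), from the sequents $\vdash\varphi$, $\varphi\in\Phi$. A *substructural logic* $\mathbf L$ is an axiomatic extension of $\mathbf{FL_e}$: there is a set $\Delta$ of formulas closed under substitution such that $\Phi\vdash_{\mathbf L}\psi$ iff $\Phi\cup\Delta\vdash_{\mathbf{FL_e}}\psi$. $\mathsf V(\mathbf L)$ is the class of $\mathrm{FL_e}$-algebras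 in which $1\le\varphi$ holds under every valuation, for every theorem $\varphi$ of $\mathbf L$. For a binary operation $\Rightarrow$ on an $\mathrm{FL_e}$-algebra $\mathbf A$, the pair $(\mathbf A,\Rightarrow)$ is *proto-connexive* if for all $x,y\in A$ $$1\le\neg(x\Rightarrow\neg x),\quad 1\le\neg(\neg x\Rightarrow x),\quad 1\le(x\Rightarrow y)\Rightarrow\neg(x\Rightarrow\neg y),\quad 1\le(x\Rightarrow\neg y)\Rightarrow\neg(x\Rightarrow y),$$ and *connexive* if moreover $x\Rightarrow y\ne y\Rightarrow x$ for some $x,y\in A$. For $\Rightarrow\,\in\{\Rightarrow_\circ,\Rightarrow_\wedge\}$, $(\mathbf L,\Rightarrow)$ is *connexive* if $(\mathbf A,\Rightarrow)$ is proto-connexive for every $\mathbf A\in\mathsf V(\mathbf L)$ and connexive for at least one $\mathbf A\in\mathsf V(\mathbf L)$. A formula is *satisfied* in $\mathbf A$ under a valuation if its value is $\ge 1$. $\mathbf A$ *refutes* (K1) if for some formula $\varphi$ one of $\varphi\Rightarrow\neg\varphi$, $\neg\varphi\Rightarrow\varphi$ is satisfied in $\mathbf A$ under some valuation; $\mathbf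 A$ *refutes* (K2) if for some formulas $\varphi,\psi$ both $\varphi\Rightarrow\psi$ and $\varphi\Rightarrow\neg\psi$ are satisfied in $\mathbf A$ under the same valuation. $(\mathbf L,\Rightarrow)$ is *strongly connexive* if it is connexive and no nontrivial $\mathbf A\in\mathsf V(\mathbf L)$ refutes (K1) or (K2). **Theorem.** 1. Let $\Rightarrow\,\in\{\Rightarrow_\circ,\Rightarrow_\wedge\}$ and let $\mathbf L$ be a substructural logic such that $(\mathbf L,\Rightarrow)$ is connexive. Then $(\mathbf L,\Rightarrow)$ is strongly connexive if and only if $0\vdash_{\mathbf L}\varphi$ for every formula $\varphi$. 2. Let $\mathbf A$ be an $\mathrm{FL_e}$-algebra and $\Rightarrow\,\in\{\Rightarrow_\circ,\Rightarrow_\wedge\}$ such that $(\mathbf A,\Rightarrow)$ is proto-connexive. If $\mathbf A$ refutes (K1) or (K2) with respect to $\Rightarrow$, then $1\le 0$ in $\mathbf A$. 3. Let $\mathbf A$ be an $\mathrm{FL_e}$-algebra such that $(\mathbf A,\Rightarrow_\wedge)$ is proto-connexive. Then $\mathbf A$ refutes (K1) or (K2) with respect to $\Rightarrow_\wedge$ if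 and only if $x\le 0$ for all $x\in A$. -/

import Mathlib

universe u

namespace Connexive

/-- Formulas over `{∧, ∨, ·, →, 0, 1}` with countably many propositional variables. -/
inductive Fm : Type
  | var : ℕ → Fm
  | and : Fm → Fm → Fm
  | or : Fm → Fm → Fm
  | fus : Fm → Fm → Fm
  | imp : Fm → Fm → Fm
  | zero : Fm
  | one : Fm

/-- Negation `¬φ := φ → 0`. -/
def Fm.neg (φ : Fm) : Fm := Fm.imp φ Fm.zero

/-- The extension of a substitution to all formulas. -/
def Fm.subst (σ : ℕ → Fm) : Fm → Fm
  | Fm.var n => σ n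
  | Fm.and φ ψ => Fm.and (Fm.subst σ φ) (Fm.subst σ ψ)
  | Fm.or φ ψ => Fm.or (Fm.subst σ φ) (Fm.subst σ ψ)
  | Fm.fus φ ψ => Fm.fus (Fm.subst σ φ) (Fm.subst σ ψ)
  | Fm.imp φ ψ => Fm.imp (Fm.subst σ φ) (Fm.subst σ ψ)
  | Fm.zero => Fm.zero
  | Fm.one => Fm.one

/-- The sequent calculus `FLₑ` (full Lambek calculus with exchange), with initial sequents
`⊢ φ` for `φ ∈ H` added. Antecedents are finite multisets, so exchange is built in; the
succedent is empty (`none`) or a single formula. -/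
inductive SeqDer (H : Set Fm) : Multiset Fm → Option Fm → Prop
  | hyp (φ : Fm) : φ ∈ H → SeqDer H 0 (some φ)
  | init (φ : Fm) : SeqDer H {φ} (some φ)
  | cut (Γ S : Multiset Fm) (φ : Fm) (D : Option Fm) :
      SeqDer H Γ (some φ) → SeqDer H (φ ::ₘ S) D → SeqDer H (Γ + S) D
  | oneL (Γ : Multiset Fm) (D : Option Fm) : SeqDer H Γ D → SeqDer H (Fm.one ::ₘ Γ) D
  | oneR : SeqDer H 0 (some Fm.one)
  | zeroL : SeqDer H {Fm.zero} none
  | zeroR (Γ : Multiset Fm) : SeqDer H Γ none → SeqDer H Γ (some Fm.zero)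
  | andL₁ (Γ : Multiset Fm) (φ ψ : Fm) (D : Option Fm) :
      SeqDer H (φ ::ₘ Γ) D → SeqDer H (Fm.and φ ψ ::ₘ Γ) D
  | andL₂ (Γ : Multiset Fm) (φ ψ : Fm) (D : Option Fm) :
      SeqDer H (ψ ::ₘ Γ) D → SeqDer H (Fm.and φ ψ ::ₘ Γ) D
  | andR (Γ : Multiset Fm) (φ ψ : Fm) :
      SeqDer H Γ (some φ) → SeqDer H Γ (some ψ) → SeqDer H Γ (some (Fm.and φ ψ))
  | orL (Γ : Multiset Fm) (φ ψ : Fm) (D : Option Fm) :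
      SeqDer H (φ ::ₘ Γ) D → SeqDer H (ψ ::ₘ Γ) D → SeqDer H (Fm.or φ ψ ::ₘ Γ) D
  | orR₁ (Γ : Multiset Fm) (φ ψ : Fm) : SeqDer H Γ (some φ) → SeqDer H Γ (some (Fm.or φ ψ))
  | orR₂ (Γ : Multiset Fm) (φ ψ : Fm) : SeqDer H Γ (some ψ) → SeqDer H Γ (some (Fm.or φ ψ))
  | fusL (Γ : Multiset Fm) (φ ψ : Fm) (D : Option Fm) :
      SeqDer H (φ ::ₘ ψ ::ₘ Γ) D → SeqDer H (Fm.fus φ ψ ::ₘ Γ) D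
  | fusR (Γ S : Multiset Fm) (φ ψ : Fm) :
      SeqDer H Γ (some φ) → SeqDer H S (some ψ) → SeqDer H (Γ + S) (some (Fm.fus φ ψ))
  | impL (Γ S : Multiset Fm) (φ ψ : Fm) (D : Option Fm) :
      SeqDer H Γ (some φ) → SeqDer H (ψ ::ₘ S) D → SeqDer H (Fm.imp φ ψ ::ₘ (Γ + S)) D
  | impR (Γ : Multiset Fm) (φ ψ : Fm) :
      SeqDer H (φ ::ₘ Γ) (some ψ) → SeqDer H Γ (some (Fm.imp φ ψ))

/-- A logic: a structural consequence relation on formulas. -/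
structure Logic where
  entails : Set Fm → Fm → Prop
  refl' : ∀ (Φ : Set Fm) (φ : Fm), φ ∈ Φ → entails Φ φ
  mono' : ∀ (Φ Ψ : Set Fm) (φ : Fm), Φ ⊆ Ψ → entails Φ φ → entails Ψ φ
  trans' : ∀ (Φ Ψ : Set Fm) (φ : Fm), (∀ ψ ∈ Ψ, entails Φ ψ) → entails Ψ φ → entails Φ φ
  struct' : ∀ (σ : ℕ → Fm) (Φ : Set Fm) (φ : Fm),
    entails Φ φ → entails (Fm.subst σ '' Φ) (Fm.subst σ φ)

theorem SeqDer.trans {Φ Ψ : Set Fm} (h : ∀ ψ ∈ Ψ, SeqDer Φ 0 (some ψ)) {Γ : Multiset Fm}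
    {D : Option Fm} (hD : SeqDer Ψ Γ D) : SeqDer Φ Γ D := by
  induction hD with
  | hyp φ hφ => exact h φ hφ
  | init φ => exact .init φ
  | cut Γ S φ D _ _ ih₁ ih₂ => exact .cut Γ S φ D ih₁ ih₂
  | oneL Γ D _ ih => exact .oneL Γ D ih
  | oneR => exact .oneR
  | zeroL => exact .zeroL
  | zeroR Γ _ ih => exact .zeroR Γ ih
  | andL₁ Γ φ ψ D _ ih => exact .andL₁ Γ φ ψ D ih
  | andL₂ Γ φ ψ D _ ih => exact .andL₂ Γ φ ψ D ih
  | andR Γ φ ψ _ _ ih₁ ih₂ => exact .andR Γ φ ψ ih₁ ih₂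
  | orL Γ φ ψ D _ _ ih₁ ih₂ => exact .orL Γ φ ψ D ih₁ ih₂
  | orR₁ Γ φ ψ _ ih => exact .orR₁ Γ φ ψ ih
  | orR₂ Γ φ ψ _ ih => exact .orR₂ Γ φ ψ ih
  | fusL Γ φ ψ D _ ih => exact .fusL Γ φ ψ D ih
  | fusR Γ S φ ψ _ _ ih₁ ih₂ => exact .fusR Γ S φ ψ ih₁ ih₂
  | impL Γ S φ ψ D _ _ ih₁ ih₂ => exact .impL Γ S φ ψ D ih₁ ih₂
  | impR Γ φ ψ _ ih => exact .impR Γ φ ψ ih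

theorem SeqDer.subst (σ : ℕ → Fm) {Φ : Set Fm} {Γ : Multiset Fm} {D : Option Fm}
    (hD : SeqDer Φ Γ D) :
    SeqDer (Fm.subst σ '' Φ) (Γ.map (Fm.subst σ)) (D.map (Fm.subst σ)) := by
  induction hD with
  | hyp φ hφ => exact .hyp _ ⟨φ, hφ, rfl⟩
  | init φ => exact .init _
  | cut Γ S φ D _ _ ih₁ ih₂ =>
    rw [Multiset.map_add]
    rw [Multiset.map_cons] at ih₂
    exact .cut _ _ _ _ ih₁ ih₂
  | oneL Γ D _ ih => rw [Multiset.map_cons]; exact .oneL _ _ ih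
  | oneR => exact .oneR
  | zeroL => exact .zeroL
  | zeroR Γ _ ih => exact .zeroR _ ih
  | andL₁ Γ φ ψ D _ ih =>
    rw [Multiset.map_cons] at ih ⊢
    exact .andL₁ _ _ _ _ ih
  | andL₂ Γ φ ψ D _ ih =>
    rw [Multiset.map_cons] at ih ⊢
    exact .andL₂ _ _ _ _ ih
  | andR Γ φ ψ _ _ ih₁ ih₂ => exact .andR _ _ _ ih₁ ih₂
  | orL Γ φ ψ D _ _ ih₁ ih₂ =>
    rw [Multiset.map_cons] at ih₁ ih₂ ⊢
    exact .orL _ _ _ _ ih₁ ih₂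
  | orR₁ Γ φ ψ _ ih => exact .orR₁ _ _ _ ih
  | orR₂ Γ φ ψ _ ih => exact .orR₂ _ _ _ ih
  | fusL Γ φ ψ D _ ih =>
    rw [Multiset.map_cons, Multiset.map_cons] at ih
    rw [Multiset.map_cons]
    exact .fusL _ _ _ _ ih
  | fusR Γ S φ ψ _ _ ih₁ ih₂ => rw [Multiset.map_add]; exact .fusR _ _ _ _ ih₁ ih₂
  | impL Γ S φ ψ D _ _ ih₁ ih₂ =>
    rw [Multiset.map_cons] at ih₂
    rw [Multiset.map_cons, Multiset.map_add]
    exact .impL _ _ _ _ _ ih₁ ih₂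
  | impR Γ φ ψ _ ih =>
    rw [Multiset.map_cons] at ih
    exact .impR _ _ _ ih

/-- The external logic of the sequent calculus: `Φ ⊢ ψ` iff the sequent `⊢ ψ` is derivable
from the sequents `⊢ φ` with `φ ∈ Φ`. -/
def logicFLe : Logic where
  entails Φ ψ := SeqDer Φ 0 (some ψ)
  refl' _ φ h := .hyp φ h
  mono' _ _ _ hsub h := h.trans (fun φ hφ => .hyp φ (hsub hφ))
  trans' _ _ _ h hψ := hψ.trans h
  struct' σ _ _ h := h.subst σ

/-- Substructural logics: the axiomatic extensions of `logicFLe`, obtained by adding a set `Δ`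
of axioms closed under substitution. -/
def Logic.IsSubstructural (L : Logic) : Prop :=
  ∃ Δ : Set Fm, (∀ (σ : ℕ → Fm), ∀ δ ∈ Δ, Fm.subst σ δ ∈ Δ) ∧
    ∀ (Φ : Set Fm) (ψ : Fm), L.entails Φ ψ ↔ logicFLe.entails (Φ ∪ Δ) ψ

/-- Ex falso quodlibet: `0 ⊢ φ` for every formula `φ`. -/
def Logic.ExFalso (L : Logic) : Prop := ∀ φ : Fm, L.entails {Fm.zero} φ

/-- `FLₑ`-algebras: commutative residuated lattices with a constant `0` (on which nothing is
assumed); `x ⇨ y` is the residual, and `1` is the monoid unit. -/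
class FLeAlgebra (A : Type u) extends Lattice A, CommMonoid A, Zero A, HImp A where
  residuation : ∀ x y z : A, x * y ≤ z ↔ x ≤ y ⇨ z

/-- `¬x := x → 0`. -/
def neg {A : Type u} [FLeAlgebra A] (x : A) : A := x ⇨ 0

/-- The value of a formula under a valuation. -/
def Fm.eval {A : Type u} [FLeAlgebra A] (v : ℕ → A) : Fm → A
  | Fm.var n => v n
  | Fm.and φ ψ => Fm.eval v φ ⊓ Fm.eval v ψ
  | Fm.or φ ψ => Fm.eval v φ ⊔ Fm.eval v ψ
  | Fm.fus φ ψ => Fm.eval v φ * Fm.eval v ψ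
  | Fm.imp φ ψ => Fm.eval v φ ⇨ Fm.eval v ψ
  | Fm.zero => 0
  | Fm.one => 1

/-- Membership in `V(L)`: the algebra satisfies `1 ≤ φ` for every theorem `φ` of `L`. -/
def Logic.InVariety (L : Logic) (A : Type u) [FLeAlgebra A] : Prop :=
  ∀ φ : Fm, L.entails ∅ φ → ∀ v : ℕ → A, 1 ≤ Fm.eval v φ

/-- The two candidates for a connexive implication, `⇒∘` and `⇒∧`. -/
inductive Arrow : Type
  | fusion
  | meet

/-- `x ⇒∘ y = (x → y) · (y → ¬¬x)` and `x ⇒∧ y = (x → y) ∧ (y → ¬¬x)` in an algebra. -/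
def Arrow.op {A : Type u} [FLeAlgebra A] : Arrow → A → A → A
  | Arrow.fusion, x, y => (x ⇨ y) * (y ⇨ neg (neg x))
  | Arrow.meet, x, y => (x ⇨ y) ⊓ (y ⇨ neg (neg x))

/-- The same connectives as operations on formulas. -/
def Arrow.fm : Arrow → Fm → Fm → Fm
  | Arrow.fusion, φ, ψ => Fm.fus (Fm.imp φ ψ) (Fm.imp ψ φ.neg.neg)
  | Arrow.meet, φ, ψ => Fm.and (Fm.imp φ ψ) (Fm.imp ψ φ.neg.neg)

theorem Arrow.eval_fm {A : Type u} [FLeAlgebra A] (c : Arrow) (φ ψ : Fm) (v : ℕ → A) :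
    (c.fm φ ψ).eval v = c.op (φ.eval v) (ψ.eval v) := by
  cases c <;> rfl

/-- `(A, ⇒)` is proto-connexive: Aristotle's and Boethius' theses hold in `A`. -/
structure ProtoConnexive (A : Type u) [FLeAlgebra A] (r : A → A → A) : Prop where
  aristotle₁ : ∀ x : A, 1 ≤ neg (r x (neg x))
  aristotle₂ : ∀ x : A, 1 ≤ neg (r (neg x) x)
  boethius₁ : ∀ x y : A, 1 ≤ r (r x y) (neg (r x (neg y)))
  boethius₂ : ∀ x y : A, 1 ≤ r (r x (neg y)) (neg (r x y))

/-- `(A, ⇒)` is connexive: proto-connexive, and `⇒` is not symmetric. -/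
structure ConnexiveAlg (A : Type u) [FLeAlgebra A] (r : A → A → A) : Prop where
  proto : ProtoConnexive A r
  nonsymm : ∃ x y : A, ¬ r x y ≤ r y x ∨ ¬ r y x ≤ r x y

/-- `(L, ⇒)` is connexive: every member of `V(L)` is proto-connexive, and some member is
connexive. -/
structure Logic.IsConnexive (L : Logic) (c : Arrow) : Prop where
  proto : ∀ (A : Type u) [FLeAlgebra A], L.InVariety A → ProtoConnexive A (Arrow.op (A := A) c)
  witness : ∃ (A : Type u) (_ : FLeAlgebra A), L.InVariety A ∧ ConnexiveAlg A (Arrow.op (A := A) c)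

/-- Failure of (K1) in an algebra: some formula `φ ⇒ ¬φ`, or some formula `¬φ ⇒ φ`, is
satisfiable (takes a value above `1` under some valuation). -/
def RefutesK1 (A : Type u) [FLeAlgebra A] (c : Arrow) : Prop :=
  ∃ (φ : Fm) (v : ℕ → A),
    1 ≤ (c.fm φ φ.neg).eval v ∨ 1 ≤ (c.fm φ.neg φ).eval v

/-- Failure of (K2) in an algebra: some formulas `φ ⇒ ψ` and `φ ⇒ ¬ψ` are simultaneously
satisfiable. -/
def RefutesK2 (A : Type u) [FLeAlgebra A] (c : Arrow) : Prop :=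
  ∃ (φ ψ : Fm) (v : ℕ → A),
    1 ≤ (c.fm φ ψ).eval v ∧ 1 ≤ (c.fm φ ψ.neg).eval v

/-- `(L, ⇒)` is strongly connexive: connexive, and (K1) and (K2) hold in every model of `L`,
i.e. in every nontrivial member of `V(L)`. -/
structure Logic.IsStronglyConnexive (L : Logic) (c : Arrow) : Prop where
  connexive : Logic.IsConnexive.{u} L c
  k1 : ∀ (A : Type u) [FLeAlgebra A] [Nontrivial A], L.InVariety A → ¬ RefutesK1 A c
  k2 : ∀ (A : Type u) [FLeAlgebra A] [Nontrivial A], L.InVariety A → ¬ RefutesK2 A c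

end Connexive

/-! A refutation of (K2) at `x`, `y` composes, after contraposing, to `1 ≤ x ⇒ ¬x`, so every
refutation meets one of Aristotle's theses and forces `1 ≤ 0` (`ProtoConnexive.one_le_zero`). For
`⇒∧`, Boethius' thesis at `(1, 1)` then gives `0 · 0 ≤ 0`, hence `¬0 = 0`, and at `(x ⊔ 0, 0)` it
gives `x ≤ 0` (`ProtoConnexive.le_zero`).

Ex falso yields strong connexivity, since a model with `1 ≤ 0` then has `1 ≤ x` for all `x` and is
trivial. For the converse, a model with `0 = 1` refutes (K1) at `1`, so adding `0` and `0 → 1` to a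
strongly connexive logic gives an inconsistent theory. By the deduction theorem some closed formula
`((0 → 1) ∧ 1)ⁿ` then lies below a variable, hence below every formula, in the Lindenbaum algebra of
the theory of `0` (`Lindenbaum.exists_bot`). A least element and `1 ≤ 0` refute (K1) by Boethius'
thesis (`ProtoConnexive.refutesK1_of_bot`), so that algebra is trivial: `0` proves everything. -/

namespace Connexive

/-! ### Residuals, negation and the two arrows in an `FLₑ`-algebra. -/

section Algebra

variable {A : Type u} [FLeAlgebra A]

instance : IsOrderedMonoid A where
  mul_le_mul_left a b hab c :=
    (FLeAlgebra.residuation a c (b * c)).2 (hab.trans ((FLeAlgebra.residuation b c _).1 le_rfl))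

theorem le_himp {x y z : A} : x ≤ y ⇨ z ↔ x * y ≤ z :=
  (FLeAlgebra.residuation x y z).symm

theorem himp_mul_le (x y : A) : (x ⇨ y) * x ≤ y :=
  le_himp.1 le_rfl

theorem one_le_himp {x y : A} : 1 ≤ x ⇨ y ↔ x ≤ y := by
  rw [le_himp, one_mul]

theorem one_himp (x : A) : 1 ⇨ x = x :=
  le_antisymm (by simpa using himp_mul_le 1 x) (le_himp.2 (mul_one x).le)

theorem le_neg {x y : A} : x ≤ neg y ↔ x * y ≤ 0 := le_himp

theorem one_le_neg {x : A} : 1 ≤ neg x ↔ x ≤ 0 := one_le_himp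

theorem neg_one : neg (1 : A) = 0 := one_himp 0

theorem neg_mul_le (x : A) : neg x * x ≤ 0 := himp_mul_le x 0

theorem le_neg_neg (x : A) : x ≤ neg (neg x) :=
  le_neg.2 (mul_comm x _ ▸ neg_mul_le x)

theorem neg_anti {x y : A} (h : x ≤ y) : neg y ≤ neg x :=
  le_neg.2 ((mul_le_mul_right h _).trans (neg_mul_le y))

theorem himp_mul_himp_le (x y z : A) : (x ⇨ y) * (y ⇨ z) ≤ x ⇨ z := by
  rw [le_himp, mul_right_comm, mul_comm]
  exact (mul_le_mul_right (himp_mul_le x y) _).trans (himp_mul_le y z)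

theorem himp_le_neg_himp_neg (x y : A) : x ⇨ y ≤ neg y ⇨ neg x :=
  le_himp.2 (himp_mul_himp_le x y 0)

theorem himp_neg_neg_le (x y : A) : y ⇨ neg (neg x) ≤ neg x ⇨ neg y := by
  refine (himp_le_neg_himp_neg y _).trans (le_himp.2 ?_)
  exact (mul_le_mul_right (le_neg_neg (neg x)) _).trans (himp_mul_le _ _)

theorem Arrow.one_le_op (c : Arrow) {x y : A} (h₁ : x ≤ y) (h₂ : y ≤ neg (neg x)) :
    1 ≤ c.op x y := by
  cases c with
  | fusion => exact one_le_mul (one_le_himp.2 h₁) (one_le_himp.2 h₂)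
  | meet => exact le_inf (one_le_himp.2 h₁) (one_le_himp.2 h₂)

theorem Arrow.one_le_meet_op {x y : A} :
    1 ≤ Arrow.meet.op x y ↔ x ≤ y ∧ y ≤ neg (neg x) := by
  simp [Arrow.op, one_le_himp]

/-- Contraposition turns `x → ¬y` into `y → ¬x` and `y → ¬¬x` into `¬x → ¬y`; chaining through `y`
and `¬y` gives the two halves of `x ⇒ ¬x`. This reduces (K2) to (K1). -/
theorem Arrow.one_le_op_self_neg (c : Arrow) {x y : A} (h₁ : 1 ≤ c.op x y)
    (h₂ : 1 ≤ c.op x (neg y)) : 1 ≤ c.op x (neg x) := by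
  cases c with
  | fusion =>
    have h := one_le_mul h₁ h₂
    simp only [Arrow.op] at h ⊢
    rw [mul_mul_mul_comm] at h
    refine h.trans (mul_le_mul' ?_ ?_)
    · refine (mul_le_mul_right ?_ _).trans (himp_mul_himp_le x y (neg x))
      rw [le_himp, le_neg, mul_assoc, mul_comm y x, ← mul_assoc]
      exact (mul_le_mul_left (himp_mul_le x (neg y)) y).trans (neg_mul_le y)
    · exact (mul_le_mul_left (himp_neg_neg_le x y) _).trans (himp_mul_himp_le _ _ _)
  | meet =>
    rw [one_le_meet_op] at h₁ h₂ ⊢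
    have hy : y ≤ neg x := (le_neg_neg y).trans (neg_anti h₂.1)
    have hx : neg x ≤ neg y := (le_neg_neg (neg x)).trans (neg_anti h₁.2)
    exact ⟨h₁.1.trans hy, hx.trans h₂.2⟩

/-! ### Consequences of proto-connexivity and of `1 ≤ 0`. -/

theorem ProtoConnexive.one_le_zero {c : Arrow} (h : ProtoConnexive A (Arrow.op (A := A) c))
    (hK : RefutesK1 A c ∨ RefutesK2 A c) : (1 : A) ≤ 0 := by
  rcases hK with ⟨φ, v, h₁ | h₁⟩ | ⟨φ, ψ, v, h₁, h₂⟩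
  · rw [Arrow.eval_fm] at h₁
    exact h₁.trans (one_le_neg.1 (h.aristotle₁ (φ.eval v)))
  · rw [Arrow.eval_fm] at h₁
    exact h₁.trans (one_le_neg.1 (h.aristotle₂ (φ.eval v)))
  · rw [Arrow.eval_fm] at h₁ h₂
    exact (c.one_le_op_self_neg h₁ h₂).trans (one_le_neg.1 (h.aristotle₁ (φ.eval v)))

theorem refutesK1_of_one_le {c : Arrow} (x : A) (h : 1 ≤ c.op x (neg x)) : RefutesK1 A c :=
  ⟨.var 0, fun _ => x, .inl (by rw [Arrow.eval_fm]; exact h)⟩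

theorem neg_zero_mul_zero_le : neg (0 : A) * 0 ≤ 0 := neg_mul_le 0

theorem ProtoConnexive.zero_mul_zero_le
    (h : ProtoConnexive A (Arrow.op (A := A) Arrow.meet)) (h0 : (1 : A) ≤ 0) :
    (0 : A) * 0 ≤ 0 := by
  have hb := (Arrow.one_le_meet_op.1 (h.boethius₁ 1 1)).2
  set b : A := Arrow.meet.op 1 (neg 1) with hb_def
  have ha : Arrow.meet.op (1 : A) 1 ≤ 1 := by
    simp only [Arrow.op, one_himp]; exact inf_le_left
  have hb' : neg b ≤ 0 ⇨ 0 := by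
    have := neg_anti ha
    rw [neg_one] at this
    exact hb.trans (neg_anti this)
  -- The second half of `b` is `¬1 → ¬¬1 = 0 → ¬0`, which is `¬(0 · 0)` by currying.
  have h2 : b ≤ neg ((0 : A) * 0) := by
    rw [hb_def, neg_one]
    refine inf_le_right.trans ?_
    rw [neg_one, le_neg, ← mul_assoc]
    exact (mul_le_mul_left (himp_mul_le _ _) _).trans neg_zero_mul_zero_le
  have h3 : (0 : A) * 0 ≤ neg b := (le_neg_neg _).trans (neg_anti h2)
  have h4 : (0 : A) * 0 * 0 ≤ 0 := le_himp.1 (h3.trans hb')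
  exact (le_mul_of_one_le_right' h0).trans h4

theorem ProtoConnexive.le_zero (h : ProtoConnexive A (Arrow.op (A := A) Arrow.meet))
    (h0 : (1 : A) ≤ 0) (x : A) : x ≤ 0 := by
  have h00 := h.zero_mul_zero_le h0
  have hneg0 : neg (0 : A) = 0 :=
    le_antisymm ((neg_anti h0).trans neg_one.le) (le_neg.2 h00)
  -- Joining with `0` puts `w` above `1`, so that `w ≤ w * w`.
  set w : A := x ⊔ 0 with hw
  have hw0 : 0 ≤ w := le_sup_right
  have hw1 : 1 ≤ w := h0.trans hw0
  have hnw : neg w ≤ 0 := (neg_anti hw0).trans hneg0.le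
  have hb := (Arrow.one_le_meet_op.1 (h.boethius₁ w 0)).2
  rw [hneg0] at hb
  -- As `¬0 = 0`, both arrows in the thesis are `a = w ⇒ 0`, and `hb` reads `¬a ≤ ¬¬a`. Thus `w ≤
  -- ¬a` makes `w * w` at most `¬¬a * ¬a ≤ 0`.
  have ha : Arrow.meet.op w 0 ≤ neg w := inf_le_left
  have h2 : w ≤ neg (Arrow.meet.op w 0) := (le_neg_neg w).trans (neg_anti ha)
  have h3 : w * w ≤ 0 :=
    (mul_le_mul' (h2.trans hb) h2).trans (neg_mul_le _)
  exact le_sup_left.trans ((le_mul_of_one_le_right' hw1).trans h3)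

theorem refutesK1_of_forall_le_zero (c : Arrow) (h : ∀ x : A, x ≤ 0) : RefutesK1 A c :=
  refutesK1_of_one_le 0 (c.one_le_op (le_neg.2 (h _)) (le_neg.2 (h _)))

theorem refutesK1_of_zero_eq_one (c : Arrow) (h : (0 : A) = 1) : RefutesK1 A c := by
  refine refutesK1_of_one_le 1 (c.one_le_op ?_ ?_)
  · rw [neg_one, h]
  · rw [neg_one, h, neg_one, h]

/-- In the presence of a least element, `1 ≤ 0` makes Boethius' thesis an instance of a
refutation of (K1). -/
theorem ProtoConnexive.refutesK1_of_bot {c : Arrow}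
    (h : ProtoConnexive A (Arrow.op (A := A) c)) (h0 : (1 : A) ≤ 0) {b : A} (hb : ∀ x, b ≤ x) :
    RefutesK1 A c := by
  have htop (x y : A) : x ≤ b ⇨ y := by
    rw [le_himp, mul_comm, ← le_himp]; exact hb _
  have h₁ : b ⇨ 1 = b ⇨ neg (1 : A) := le_antisymm (htop _ _) (htop _ _)
  -- Since `¬b` is the greatest element, it absorbs a factor `0`, whence `¬¬b * 0 ≤ ¬¬b`; the other
  -- inequality uses `1 ≤ 0`.
  have h₂ : 1 ⇨ neg (neg b) = neg 1 ⇨ neg (neg b) := by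
    rw [one_himp, neg_one]
    refine le_antisymm (le_himp.2 (le_neg.2 ?_)) ?_
    · rw [mul_assoc]
      exact (mul_le_mul_right (htop _ _) _).trans (neg_mul_le _)
    · exact (le_mul_of_one_le_right' h0).trans (himp_mul_le _ _)
  have h₃ : c.op b 1 = c.op b (neg 1) := by
    cases c <;> simp only [Arrow.op, h₁, h₂]
  -- With `y = b ⇒ 1 = b ⇒ ¬1`, this is `1 ≤ y ⇒ ¬y`.
  have := h.boethius₁ b 1
  rw [← h₃] at this
  exact refutesK1_of_one_le _ this

/-! ### Soundness and the algebraic form of the local deduction theorem. -/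

/-- Soundness relative to the filter generated by `e`. -/
theorem SeqDer.exists_pow_mul_le {H : Set Fm} {v : ℕ → A} {e : A} (he : e ≤ 1)
    (hH : ∀ φ ∈ H, ∃ n : ℕ, e ^ n ≤ φ.eval v) {Γ : Multiset Fm} {D : Option Fm}
    (hD : SeqDer H Γ D) :
    ∃ n : ℕ, e ^ n * (Γ.map (Fm.eval v)).prod ≤ D.elim 0 (Fm.eval v) := by
  -- Premises sharing a context may need different exponents; as `e ≤ 1`, both can be raised to a
  -- common one.
  have hmono {m n : ℕ} {x y : A} (hmn : m ≤ n) (h : e ^ m * x ≤ y) : e ^ n * x ≤ y :=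
    (mul_le_mul_left (pow_le_pow_right_of_le_one' he hmn) x).trans h
  induction hD with
  | hyp φ hφ =>
    obtain ⟨n, hn⟩ := hH φ hφ
    exact ⟨n, by simpa using hn⟩
  | init φ => exact ⟨0, by simp⟩
  | cut Γ S φ D _ _ ih₁ ih₂ =>
    obtain ⟨m, hm⟩ := ih₁
    obtain ⟨n, hn⟩ := ih₂
    refine ⟨n + m, ?_⟩
    simp only [Multiset.map_cons, Multiset.prod_cons, Multiset.map_add, Multiset.prod_add,
      Option.elim] at *
    refine le_trans ?_ ((mul_le_mul_right (mul_le_mul_left hm _) _).trans hn)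
    rw [pow_add, mul_assoc, mul_assoc]
  | oneL Γ D _ ih => simpa [Fm.eval] using ih
  | oneR => exact ⟨0, by simp [Fm.eval]⟩
  | zeroL => exact ⟨0, by simp [Fm.eval]⟩
  | zeroR Γ _ ih => simpa [Fm.eval] using ih
  | andL₁ Γ φ ψ D _ ih =>
    obtain ⟨n, hn⟩ := ih
    refine ⟨n, le_trans ?_ hn⟩
    simp only [Multiset.map_cons, Multiset.prod_cons, Fm.eval]
    gcongr
    exact inf_le_left
  | andL₂ Γ φ ψ D _ ih =>
    obtain ⟨n, hn⟩ := ih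
    refine ⟨n, le_trans ?_ hn⟩
    simp only [Multiset.map_cons, Multiset.prod_cons, Fm.eval]
    gcongr
    exact inf_le_right
  | andR Γ φ ψ _ _ ih₁ ih₂ =>
    obtain ⟨m, hm⟩ := ih₁
    obtain ⟨n, hn⟩ := ih₂
    exact ⟨m + n, le_inf (hmono (Nat.le_add_right m n) hm) (hmono (Nat.le_add_left n m) hn)⟩
  | orL Γ φ ψ D _ _ ih₁ ih₂ =>
    obtain ⟨m, hm⟩ := ih₁
    obtain ⟨n, hn⟩ := ih₂
    refine ⟨m + n, ?_⟩
    have hm' := hmono (Nat.le_add_right m n) hm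
    have hn' := hmono (Nat.le_add_left n m) hn
    simp only [Multiset.map_cons, Multiset.prod_cons, Fm.eval] at *
    rw [mul_left_comm, ← le_himp] at *
    exact sup_le hm' hn'
  | orR₁ Γ φ ψ _ ih =>
    obtain ⟨n, hn⟩ := ih
    exact ⟨n, hn.trans le_sup_left⟩
  | orR₂ Γ φ ψ _ ih =>
    obtain ⟨n, hn⟩ := ih
    exact ⟨n, hn.trans le_sup_right⟩
  | fusL Γ φ ψ D _ ih => simpa [Fm.eval, mul_assoc] using ih
  | fusR Γ S φ ψ _ _ ih₁ ih₂ =>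
    obtain ⟨m, hm⟩ := ih₁
    obtain ⟨n, hn⟩ := ih₂
    refine ⟨m + n, ?_⟩
    rw [Multiset.map_add, Multiset.prod_add, pow_add, mul_mul_mul_comm]
    exact mul_le_mul' hm hn
  | impL Γ S φ ψ D _ _ ih₁ ih₂ =>
    obtain ⟨m, hm⟩ := ih₁
    obtain ⟨n, hn⟩ := ih₂
    refine ⟨n + m, ?_⟩
    simp only [Multiset.map_cons, Multiset.prod_cons, Multiset.map_add, Multiset.prod_add,
      Option.elim, Fm.eval] at *
    refine le_trans ?_ ((mul_le_mul_right (mul_le_mul_left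
      ((mul_le_mul_right hm _).trans (himp_mul_le _ _)) _) _).trans hn)
    rw [pow_add]
    apply le_of_eq
    ac_rfl
  | impR Γ φ ψ _ ih =>
    obtain ⟨n, hn⟩ := ih
    refine ⟨n, le_himp.2 ?_⟩
    rw [Multiset.map_cons, Multiset.prod_cons, mul_left_comm] at hn
    rwa [mul_comm]

theorem SeqDer.one_le_eval {H : Set Fm} {v : ℕ → A} (hH : ∀ φ ∈ H, 1 ≤ φ.eval v) {φ : Fm}
    (h : SeqDer H 0 (some φ)) : 1 ≤ φ.eval v := by
  obtain ⟨n, hn⟩ := h.exists_pow_mul_le (e := 1) le_rfl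
    (fun φ hφ => ⟨0, by simpa using hH φ hφ⟩)
  simpa using hn

end Algebra

/-! ### The Lindenbaum algebra as an `FLₑ`-algebra. -/

section Lindenbaum

variable {H : Set Fm}

theorem SeqDer.singleton_trans {φ ψ χ : Fm} (h₁ : SeqDer H {φ} (some ψ))
    (h₂ : SeqDer H {ψ} (some χ)) : SeqDer H {φ} (some χ) :=
  .cut {φ} 0 ψ _ h₁ h₂

theorem SeqDer.imp_mp {φ ψ : Fm} {Γ : Multiset Fm} (h : SeqDer H Γ (some (φ.imp ψ))) :
    SeqDer H (φ ::ₘ Γ) (some ψ) := by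
  have := SeqDer.cut Γ {φ} _ _ h (.impL {φ} 0 φ ψ _ (.init φ) (.init ψ))
  rwa [add_comm, Multiset.singleton_add] at this

theorem SeqDer.fus_inv {φ ψ : Fm} {D : Option Fm} (h : SeqDer H {φ.fus ψ} D) :
    SeqDer H (ψ ::ₘ {φ}) D :=
  .cut ({ψ} + {φ}) 0 (φ.fus ψ) D
    (by rw [add_comm]; exact .fusR {φ} {ψ} φ ψ (.init φ) (.init ψ)) h

theorem SeqDer.fus_mono {φ φ' ψ ψ' : Fm} (h₁ : SeqDer H {φ} (some φ'))
    (h₂ : SeqDer H {ψ} (some ψ')) : SeqDer H {φ.fus ψ} (some (φ'.fus ψ')) :=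
  .fusL 0 φ ψ _ (.fusR {φ} {ψ} φ' ψ' h₁ h₂)

theorem SeqDer.imp_mono {φ φ' ψ ψ' : Fm} (h₁ : SeqDer H {φ'} (some φ))
    (h₂ : SeqDer H {ψ} (some ψ')) : SeqDer H {φ.imp ψ} (some (φ'.imp ψ')) :=
  .impR _ _ _ (by
    have := SeqDer.impL {φ'} 0 φ ψ _ h₁ h₂
    rwa [add_zero, ← Multiset.cons_zero, Multiset.cons_swap] at this)

theorem SeqDer.fus_assoc (φ ψ χ : Fm) :
    SeqDer H {(φ.fus ψ).fus χ} (some (φ.fus (ψ.fus χ))) :=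
  .fusL 0 _ _ _ (.fusL _ _ _ _
    (.fusR {φ} {ψ, χ} _ _ (.init _) (.fusR {ψ} {χ} _ _ (.init _) (.init _))))

theorem SeqDer.fus_comm (φ ψ : Fm) : SeqDer H {φ.fus ψ} (some (ψ.fus φ)) :=
  .fusL 0 _ _ _ (by
    rw [Multiset.cons_swap]
    exact .fusR {ψ} {φ} _ _ (.init _) (.init _))

/-- Interderivability over the axioms `H`. -/
def interderivable (H : Set Fm) : Setoid (ULift.{u} Fm) where
  r φ ψ := SeqDer H {φ.down} (some ψ.down) ∧ SeqDer H {ψ.down} (some φ.down)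
  iseqv :=
    { refl := fun _ => ⟨.init _, .init _⟩
      symm := fun h => ⟨h.2, h.1⟩
      trans := fun h k => ⟨h.1.singleton_trans k.1, k.2.singleton_trans h.2⟩ }

/-- The Lindenbaum algebra of the theory axiomatized by `H`. -/
def Lindenbaum (H : Set Fm) : Type u := Quotient (interderivable.{u} H)

namespace Lindenbaum

/-- The class of a formula. -/
def mk (H : Set Fm) (φ : Fm) : Lindenbaum.{u} H := Quotient.mk (interderivable H) ⟨φ⟩

theorem mk_surjective (x : Lindenbaum.{u} H) : ∃ φ, mk H φ = x :=
  Quotient.inductionOn x fun φ => ⟨φ.down, rfl⟩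

/-- A binary connective respecting interderivability, on classes. -/
def lift₂ (f : Fm → Fm → Fm)
    -- Both directions are supplied for the first argument because implication is antitone there.
    (hf : ∀ φ φ' ψ ψ', SeqDer H {φ} (some φ') → SeqDer H {φ'} (some φ) →
      SeqDer H {ψ} (some ψ') → SeqDer H {f φ ψ} (some (f φ' ψ'))) :
    Lindenbaum.{u} H → Lindenbaum.{u} H → Lindenbaum.{u} H :=
  Quotient.map₂ (fun φ ψ => ⟨f φ.down ψ.down⟩) fun _ _ h _ _ k =>
    ⟨hf _ _ _ _ h.1 h.2 k.1, hf _ _ _ _ h.2 h.1 k.2⟩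

theorem and_mono {φ φ' ψ ψ' : Fm} (h₁ : SeqDer H {φ} (some φ'))
    (h₂ : SeqDer H {ψ} (some ψ')) : SeqDer H {φ.and ψ} (some (φ'.and ψ')) :=
  .andR _ _ _ (.andL₁ 0 _ _ _ h₁) (.andL₂ 0 _ _ _ h₂)

theorem or_mono {φ φ' ψ ψ' : Fm} (h₁ : SeqDer H {φ} (some φ'))
    (h₂ : SeqDer H {ψ} (some ψ')) : SeqDer H {φ.or ψ} (some (φ'.or ψ')) :=
  .orL 0 _ _ _ (.orR₁ _ _ _ h₁) (.orR₂ _ _ _ h₂)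

instance : LE (Lindenbaum.{u} H) where
  le := Quotient.lift₂ (fun φ ψ => SeqDer H {φ.down} (some ψ.down)) fun _ _ _ _ h k =>
    propext ⟨fun l => (h.2.singleton_trans l).singleton_trans k.1,
      fun l => (h.1.singleton_trans l).singleton_trans k.2⟩

theorem mk_le_mk {φ ψ : Fm} : mk.{u} H φ ≤ mk H ψ ↔ SeqDer H {φ} (some ψ) := Iff.rfl

theorem mk_eq_mk {φ ψ : Fm} (h₁ : SeqDer H {φ} (some ψ)) (h₂ : SeqDer H {ψ} (some φ)) :
    mk.{u} H φ = mk H ψ :=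
  Quotient.sound ⟨h₁, h₂⟩

instance : FLeAlgebra (Lindenbaum.{u} H) where
  inf := lift₂ Fm.and fun _ _ _ _ h _ k => and_mono h k
  sup := lift₂ Fm.or fun _ _ _ _ h _ k => or_mono h k
  mul := lift₂ Fm.fus fun _ _ _ _ h _ k => h.fus_mono k
  himp := lift₂ Fm.imp fun _ _ _ _ _ h k => h.imp_mono k
  one := mk H .one
  zero := mk H .zero
  le_refl x := by
    obtain ⟨φ, rfl⟩ := mk_surjective x
    exact .init φ
  le_trans x y z := by
    obtain ⟨φ, rfl⟩ := mk_surjective x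
    obtain ⟨ψ, rfl⟩ := mk_surjective y
    obtain ⟨χ, rfl⟩ := mk_surjective z
    exact fun h k => SeqDer.singleton_trans (mk_le_mk.{u}.1 h) (mk_le_mk.{u}.1 k)
  le_antisymm x y := by
    obtain ⟨φ, rfl⟩ := mk_surjective x
    obtain ⟨ψ, rfl⟩ := mk_surjective y
    exact fun h k => mk_eq_mk h k
  inf_le_left x y := by
    obtain ⟨φ, rfl⟩ := mk_surjective x
    obtain ⟨ψ, rfl⟩ := mk_surjective y
    exact SeqDer.andL₁ 0 _ _ _ (.init φ)
  inf_le_right x y := by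
    obtain ⟨φ, rfl⟩ := mk_surjective x
    obtain ⟨ψ, rfl⟩ := mk_surjective y
    exact SeqDer.andL₂ 0 _ _ _ (.init ψ)
  le_inf x y z := by
    obtain ⟨φ, rfl⟩ := mk_surjective x
    obtain ⟨ψ, rfl⟩ := mk_surjective y
    obtain ⟨χ, rfl⟩ := mk_surjective z
    exact fun h k => SeqDer.andR _ _ _ (mk_le_mk.{u}.1 h) (mk_le_mk.{u}.1 k)
  le_sup_left x y := by
    obtain ⟨φ, rfl⟩ := mk_surjective x
    obtain ⟨ψ, rfl⟩ := mk_surjective y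
    exact SeqDer.orR₁ _ _ _ (.init φ)
  le_sup_right x y := by
    obtain ⟨φ, rfl⟩ := mk_surjective x
    obtain ⟨ψ, rfl⟩ := mk_surjective y
    exact SeqDer.orR₂ _ _ _ (.init ψ)
  sup_le x y z := by
    obtain ⟨φ, rfl⟩ := mk_surjective x
    obtain ⟨ψ, rfl⟩ := mk_surjective y
    obtain ⟨χ, rfl⟩ := mk_surjective z
    exact fun h k => SeqDer.orL 0 _ _ _ (mk_le_mk.{u}.1 h) (mk_le_mk.{u}.1 k)
  mul_assoc x y z := by
    obtain ⟨φ, rfl⟩ := mk_surjective x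
    obtain ⟨ψ, rfl⟩ := mk_surjective y
    obtain ⟨χ, rfl⟩ := mk_surjective z
    refine mk_eq_mk (.fus_assoc φ ψ χ) (.fusL 0 _ _ _ ?_)
    rw [Multiset.cons_swap]
    refine .fusL _ _ _ _ ?_
    have := SeqDer.fusR (H := H) {φ, ψ} {χ} _ _ (.fusR {φ} {ψ} _ _ (.init φ) (.init ψ)) (.init χ)
    convert this using 1
    simp only [← Multiset.singleton_add, Multiset.insert_eq_cons]
    abel
  mul_comm x y := by
    obtain ⟨φ, rfl⟩ := mk_surjective x
    obtain ⟨ψ, rfl⟩ := mk_surjective y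
    exact mk_eq_mk (.fus_comm φ ψ) (.fus_comm ψ φ)
  one_mul x := by
    obtain ⟨φ, rfl⟩ := mk_surjective x
    exact mk_eq_mk (.fusL 0 _ _ _ (.oneL _ _ (.init φ))) (.fusR 0 {φ} _ _ .oneR (.init φ))
  mul_one x := by
    obtain ⟨φ, rfl⟩ := mk_surjective x
    refine mk_eq_mk (.fusL 0 _ _ _ ?_) (.fusR {φ} 0 _ _ (.init φ) .oneR)
    rw [Multiset.cons_swap]
    exact .oneL _ _ (.init φ)
  residuation x y z := by
    obtain ⟨φ, rfl⟩ := mk_surjective x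
    obtain ⟨ψ, rfl⟩ := mk_surjective y
    obtain ⟨χ, rfl⟩ := mk_surjective z
    refine ⟨fun h => SeqDer.impR _ _ _ (SeqDer.fus_inv h), fun h => SeqDer.fusL 0 _ _ _ ?_⟩
    rw [Multiset.cons_swap]
    exact SeqDer.imp_mp h

theorem one_le_mk {φ : Fm} : 1 ≤ mk.{u} H φ ↔ SeqDer H 0 (some φ) :=
  ⟨fun h => .cut 0 0 .one _ .oneR h, fun h => .oneL _ _ h⟩

theorem eval_mk (σ : ℕ → Fm) (φ : Fm) :
    φ.eval (fun n => mk.{u} H (σ n)) = mk H (φ.subst σ) := by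
  induction φ with
  | var n => rfl
  | zero => rfl
  | one => rfl
  | and φ ψ ih₁ ih₂ => rw [Fm.eval, ih₁, ih₂]; rfl
  | or φ ψ ih₁ ih₂ => rw [Fm.eval, ih₁, ih₂]; rfl
  | fus φ ψ ih₁ ih₂ => rw [Fm.eval, ih₁, ih₂]; rfl
  | imp φ ψ ih₁ ih₂ => rw [Fm.eval, ih₁, ih₂]; rfl

/-- Valuations here are substitutions, and theorems of `L` are closed under these. Hence `Φ` itself
need not be. -/
theorem inVariety {L : Logic} {Δ : Set Fm}
    (hL : ∀ (Φ : Set Fm) (ψ : Fm), L.entails Φ ψ ↔ logicFLe.entails (Φ ∪ Δ) ψ)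
    (Φ : Set Fm) : L.InVariety (Lindenbaum.{u} (Φ ∪ Δ)) := by
  intro φ hφ v
  choose σ hσ using fun n => mk_surjective (v n)
  obtain rfl : (fun n => mk (Φ ∪ Δ) (σ n)) = v := funext hσ
  rw [eval_mk, one_le_mk]
  have h := L.struct' σ ∅ φ hφ
  rw [Set.image_empty] at h
  exact (hL Φ _).1 (L.mono' ∅ Φ _ (Set.empty_subset _) h)

theorem nontrivial {φ : Fm} (h : ¬ SeqDer H 0 (some φ)) : Nontrivial (Lindenbaum.{u} H) :=
  ⟨⟨1, mk H φ, fun he => h (one_le_mk.{u}.1 he.le)⟩⟩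

end Lindenbaum

end Lindenbaum

/-! ### A least element from inconsistency, and ex falso. -/

/-- The formula `((0 → 1) ∧ 1)ⁿ`. -/
def Fm.zeroImpOnePow : ℕ → Fm
  | 0 => .one
  | n + 1 => (Fm.zeroImpOnePow n).fus ((Fm.zero.imp .one).and .one)

theorem Fm.subst_zeroImpOnePow (σ : ℕ → Fm) (n : ℕ) :
    (Fm.zeroImpOnePow n).subst σ = Fm.zeroImpOnePow n := by
  induction n with
  | zero => rfl
  | succ n ih => rw [zeroImpOnePow, subst, ih]; rfl

theorem Fm.eval_zeroImpOnePow {A : Type u} [FLeAlgebra A] (v : ℕ → A) (n : ℕ) :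
    (Fm.zeroImpOnePow n).eval v = (((0 : A) ⇨ 1) ⊓ 1) ^ n := by
  induction n with
  | zero => exact (pow_zero _).symm
  | succ n ih => rw [zeroImpOnePow, eval, ih, pow_succ]; rfl

/-- If the axioms together with `0 → 1` are inconsistent, then the Lindenbaum algebra has a
least element. -/
theorem Lindenbaum.exists_bot {H : Set Fm} (hH : ∀ (σ : ℕ → Fm), ∀ φ ∈ H, φ.subst σ ∈ H)
    (h : SeqDer (insert (Fm.zero.imp .one) H) 0 (some (.var 0))) :
    ∃ b : Lindenbaum.{u} H, ∀ x, b ≤ x := by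
  obtain ⟨n, hn⟩ := h.exists_pow_mul_le (v := fun n => mk.{u} H (.var n))
    (e := (0 ⇨ 1) ⊓ 1) inf_le_right (by
      rintro φ (rfl | hφ)
      · exact ⟨1, by rw [pow_one]; exact inf_le_left⟩
      · refine ⟨0, ?_⟩
        rw [pow_zero, eval_mk, one_le_mk.{u}]
        exact .hyp _ (hH _ _ hφ))
  simp only [Multiset.map_zero, Multiset.prod_zero, mul_one, Option.elim] at hn
  rw [← Fm.eval_zeroImpOnePow (fun n => mk.{u} H (.var n)), eval_mk, eval_mk,
    Fm.subst_zeroImpOnePow, mk_le_mk.{u}] at hn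
  refine ⟨mk.{u} H (Fm.zeroImpOnePow n), fun x => ?_⟩
  obtain ⟨φ, rfl⟩ := mk_surjective x
  -- Substituting `φ` for the variable fixes the closed power, so the same power lies below every
  -- class.
  have h := (hn.subst (fun _ => φ)).trans (Φ := H) (by
    rintro _ ⟨ψ, hψ, rfl⟩
    exact .hyp _ (hH _ _ hψ))
  rw [Multiset.map_singleton, Fm.subst_zeroImpOnePow] at h
  exact h

theorem Logic.IsStronglyConnexive.exFalso {L : Logic} {c : Arrow} (hL : L.IsSubstructural)
    (h : Logic.IsStronglyConnexive.{u} L c) : L.ExFalso := by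
  obtain ⟨Δ, hΔ, hL⟩ := hL
  intro φ
  by_contra hφ
  rw [hL] at hφ
  -- Otherwise the Lindenbaum algebra of this theory is a nontrivial model with `0 = 1`.
  have hvar : SeqDer ({Fm.zero.imp .one, .zero} ∪ Δ) 0 (some (.var 0)) := by
    by_contra hvar
    have := Lindenbaum.nontrivial.{u} hvar
    refine h.k1 _ (Lindenbaum.inVariety.{u} hL {Fm.zero.imp .one, .zero})
      (refutesK1_of_zero_eq_one c ?_)
    refine le_antisymm (one_le_himp.1 ?_) ?_
    · exact Lindenbaum.one_le_mk.{u}.2 (.hyp (Fm.zero.imp .one) (by simp))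
    · exact Lindenbaum.one_le_mk.{u}.2 (.hyp Fm.zero (by simp))
  -- Splitting off `0 → 1` leaves `{0} ∪ Δ`, still closed under substitution since `0` is.
  rw [Set.insert_union] at hvar
  obtain ⟨b, hb⟩ := Lindenbaum.exists_bot.{u} (by
    rintro σ ψ (rfl | hψ)
    · exact .inl rfl
    · exact .inr (hΔ σ ψ hψ)) hvar
  have := Lindenbaum.nontrivial.{u} hφ
  have hV := Lindenbaum.inVariety.{u} hL {Fm.zero}
  refine h.k1 _ hV ((h.connexive.proto _ hV).refutesK1_of_bot ?_ hb)
  exact Lindenbaum.one_le_mk.{u}.2 (.hyp Fm.zero (by simp))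

theorem Logic.ExFalso.not_one_le_zero {L : Logic} (hL : L.IsSubstructural) (h : L.ExFalso)
    {A : Type u} [FLeAlgebra A] [Nontrivial A] (hA : L.InVariety A) : ¬ (1 : A) ≤ 0 := by
  intro h0
  obtain ⟨Δ, -, hL⟩ := hL
  -- Soundness of `0 ⊢ p` under the valuation constantly `x`; applied to residuals, it identifies
  -- all elements.
  have hone (x : A) : 1 ≤ x := by
    refine ((hL _ _).1 (h (.var 0))).one_le_eval (v := fun _ => x) ?_
    rintro ψ (rfl | hψ)
    · exact h0
    · exact hA ψ ((hL _ _).2 (.hyp _ (.inr hψ))) _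
  obtain ⟨x, y, hxy⟩ := exists_pair_ne A
  exact hxy (le_antisymm (one_le_himp.1 (hone _)) (one_le_himp.1 (hone _)))

theorem Logic.ExFalso.isStronglyConnexive {L : Logic} {c : Arrow} (hL : L.IsSubstructural)
    (hc : Logic.IsConnexive.{u} L c) (h : L.ExFalso) : Logic.IsStronglyConnexive.{u} L c where
  connexive := hc
  k1 A _ _ hA hK := h.not_one_le_zero hL hA ((hc.proto A hA).one_le_zero (.inl hK))
  k2 A _ _ hA hK := h.not_one_le_zero hL hA ((hc.proto A hA).one_le_zero (.inr hK))

end Connexive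

theorem mainTheorem12 :
    (∀ (c : Connexive.Arrow) (L : Connexive.Logic), L.IsSubstructural →
      Connexive.Logic.IsConnexive.{u} L c →
      (Connexive.Logic.IsStronglyConnexive.{u} L c ↔ L.ExFalso)) ∧
    (∀ (A : Type u) [Connexive.FLeAlgebra A] (c : Connexive.Arrow),
      Connexive.ProtoConnexive A (Connexive.Arrow.op (A := A) c) →
      (Connexive.RefutesK1 A c ∨ Connexive.RefutesK2 A c) → (1 : A) ≤ 0) ∧
    (∀ (A : Type u) [Connexive.FLeAlgebra A],
      Connexive.ProtoConnexive A (Connexive.Arrow.op (A := A) Connexive.Arrow.meet) →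
      ((Connexive.RefutesK1 A Connexive.Arrow.meet ∨ Connexive.RefutesK2 A Connexive.Arrow.meet) ↔
        ∀ x : A, x ≤ 0)) := by
  refine ⟨fun c L hL hc => ⟨fun h => h.exFalso hL, fun h => h.isStronglyConnexive hL hc⟩,
    fun A _ c hA hK => hA.one_le_zero hK, fun A _ hA => ⟨fun hK => hA.le_zero (hA.one_le_zero hK),
      fun h => .inl (Connexive.refutesK1_of_forall_le_zero _ h)⟩⟩
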